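/- Let $\vec G$ be a finite connected symmetric digraph (no loops, no parallel arcs; $uv$ is an arc if and only if $vu$ is) with at least two vertices, and let $c$ assign a positive integer $c_{uv}$ to each arc $uv$. *Circular chromatic number.* For a real $p>0$ identify the circle $S^p$ of perimeter $p$ with $[0,p)$, and let $d(x,y)$ be $y-x$ if $x\le y$ and $p-(x-y)$ if $x>y$ (the length of the arc from $x$ to $y$ in the clockwise direction). A circular $p$-coloring of $(\vec G,c)$ is a map $\varphi:V(\vec G)\to S^p$ with $d(\varphi(u),\varphi(v))\ge c_{uv}$ for each arc $uv$, and $\chi_c(\vec G,c)$ is the infimum of all $p>0$ for which $(\vec G,c)$ has a circular $p$-coloring. *Token game.* A good initial marking $T$ assigns a nonnegative integer $T_{uv}$ (a number of tokens) to each arc $uv$ such that $T_{uv}+T_{vu}=1$ for each arc $uv$ and $\sum_{uv\in E(C)}T_{uv}>0$ for each directed cycle $C$ of $\vec G$ (directed cycles of length two included). The game starts at time $t=1$ with $T_{uv}$ tokens on each arc $uv$. A vertex is fireable at time $t$ if each arc $uv$ into it contains at least one token at time $t$. At each time $t=1,2,3,\dots$ all fireable vertices fire simultaneously: a vertex $u$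 that fires at time $t$ removes one token from each of its in-arcs, and for each out-arc $uv$ it places one token on $uv$ at time $t+c_{uv}$ (available from that time on). Let $h(t)$ be the set of vertices fireable at time $t$. **Theorem.** For each good initial marking $T$ the game is eventually periodic: there are positive integers $p$ and $M$ with $h(t+p)=h(t)$ for all $t\ge M$. Let $p_{(\vec G,c,T)}$ be the least such $p$ and let $M$ belong to it. The number of times $t\in[M,M+p_{(\vec G,c,T)})$ with $u\in h(t)$ is positive and is the same for all vertices $u$; denote it by $m_{(\vec G,c,T)}$. Moreover, $$\chi_c(\vec G,c)=\min_{T}\frac{p_{(\vec G,c,T)}}{m_{(\vec G,c,T)}},$$ where the minimum is taken over all good initial markings $T$ of $(\vec G,c)$, and is attained. -/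

import Mathlib

/-!
A symmetric digraph without loops and parallel arcs is the same thing as a `SimpleGraph`: its arcs
are the ordered pairs `(u, v)` with `G.Adj u v`, that is, the darts of the graph. A directed walk
is a `SimpleGraph.Walk`. Weights and markings are functions of two vertices of which only the
values on arcs matter.
-/

namespace TokenGame

variable {V : Type*}

/-- The length `d(x, y)` of the arc from `x` to `y` in the positive (clockwise) direction on the
circle of perimeter `p`, which is identified with `[0, p)`. -/
noncomputable def circDist (p x y : ℝ) : ℝ :=
  if x ≤ y then y - x else p - (x - y)

/-- `φ` is a circular `p`-coloring of the symmetric digraph `G` with arc weights `c`. -/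
def IsCircularColoring (G : SimpleGraph V) (c : V → V → ℝ) (p : ℝ) (φ : V → ℝ) : Prop :=
  (∀ u, φ u ∈ Set.Ico 0 p) ∧ ∀ u v, G.Adj u v → c u v ≤ circDist p (φ u) (φ v)

/-- The circular chromatic number of the symmetric digraph `G` with arc weights `c`. -/
noncomputable def circularChromaticNumber (G : SimpleGraph V) (c : V → V → ℝ) : ℝ :=
  sInf {p : ℝ | 0 < p ∧ ∃ φ : V → ℝ, IsCircularColoring G c p φ}

/-- A directed cycle: a closed directed walk of positive length without repeated vertices, except
that its first vertex is its last one. Cycles `u v u` of length two are included. -/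
def IsDicycle {G : SimpleGraph V} {u : V} (C : G.Walk u u) : Prop :=
  0 < C.length ∧ C.support.tail.Nodup

/-- The token count of a walk. -/
def tokenCount {G : SimpleGraph V} (T : V → V → ℕ) {u v : V} (C : G.Walk u v) : ℕ :=
  (C.darts.map fun a => T a.fst a.snd).sum

/-- A good initial marking: each directed cycle carries a token, and each pair of opposite arcs
carries exactly one. -/
def IsGood (G : SimpleGraph V) (T : V → V → ℕ) : Prop :=
  (∀ (u : V) (C : G.Walk u u), IsDicycle C → 0 < tokenCount T C) ∧
    ∀ u v, G.Adj u v → T u v + T v u = 1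

/-- A state of the token game at a time pulse: `tokens u v` is the number of tokens on the arc
`uv`, and `transit u v k` is the number of tokens which, because of earlier firings of `u`, will be
placed on the arc `uv` exactly `k + 1` time pulses later. -/
structure State (V : Type*) where
  tokens : V → V → ℕ
  transit : V → V → ℕ → ℕ

/-- A vertex is fireable if each of its in-arcs contains at least one token. -/
def State.Fireable (G : SimpleGraph V) (s : State V) (v : V) : Prop :=
  ∀ u, G.Adj u v → 0 < s.tokens u v

open Classical in
/-- The tokens under way right after all the fireable vertices have fired: a vertex `u` that fires
now places a token on each out-arc `uv` after `c u v` time pulses. -/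
noncomputable def State.enRoute (G : SimpleGraph V) (c : V → V → ℕ) (s : State V)
    (u v : V) (k : ℕ) : ℕ :=
  s.transit u v k + if s.Fireable G u ∧ c u v = k + 1 then 1 else 0

open Classical in
/-- One time pulse of the token game: all fireable vertices fire simultaneously, each removing one
token from each of its in-arcs; then time moves on to the next pulse, at which the tokens that are
due are placed. -/
noncomputable def State.next (G : SimpleGraph V) (c : V → V → ℕ) (s : State V) : State V where
  tokens u v := (s.tokens u v - if s.Fireable G v then 1 else 0) + s.enRoute G c u v 0
  transit u v k := s.enRoute G c u v (k + 1)

/-- The state in which the token game starts: the initial marking, and no tokens under way. -/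
def initialState (T : V → V → ℕ) : State V where
  tokens := T
  transit _ _ _ := 0

/-- The set `h(t)` of the vertices that are fireable (and fire) at time pulse `t`. The game starts
at the time pulse `1`; only `t ≥ 1` is meaningful. -/
def fireSet (G : SimpleGraph V) (c T : V → V → ℕ) (t : ℕ) : Set V :=
  {v | ((State.next G c)^[t - 1] (initialState T)).Fireable G v}

/-- From time pulse `M` on, the token game repeats itself every `p` pulses. -/
def IsPeriodicFrom (G : SimpleGraph V) (c T : V → V → ℕ) (p M : ℕ) : Prop :=
  0 < p ∧ 0 < M ∧ ∀ t, M ≤ t → fireSet G c T (t + p) = fireSet G c T t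

/-- The period of the token game: the least `p > 0` for which the game is eventually
`p`-periodic. -/
noncomputable def period (G : SimpleGraph V) (c T : V → V → ℕ) : ℕ :=
  sInf {p | ∃ M, IsPeriodicFrom G c T p M}

/-- The first time pulse from which on the token game is periodic with its period. -/
noncomputable def steadyTime (G : SimpleGraph V) (c T : V → V → ℕ) : ℕ :=
  sInf {M | IsPeriodicFrom G c T (period G c T) M}

open Classical in
/-- The number of times that the vertex `u` is fireable during one period of the steady state. -/
noncomputable def multiplicity (G : SimpleGraph V) (c T : V → V → ℕ) (u : V) : ℕ :=
  ((Finset.Ico (steadyTime G c T) (steadyTime G c T + period G c T)).filter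
    fun t => u ∈ fireSet G c T t).card

end TokenGame

/-! Let `N v n` be the number of firings of `v` in the first `n` pulses. Counting tokens gives `N v
(n + 1) ≤ T u v + N u (n + 1 - c u v)` on each arc `uv`, and when `v` idles `N v n` equals one of
these bounds (`tokens_add_firings`). Only finitely many states occur on the arcs, so the game is
eventually periodic; counts of adjacent vertices differ boundedly, so multiplicities agree; a
standstill would force a token-free directed cycle.

Each ratio `period / m` is the perimeter of a coloring: the arc inequality averaged over a period
makes `-N / m` a potential, which is then reduced modulo the ratio. Conversely, a `p`-coloring marks
the arcs that pass the origin, and by induction `v` has then fired more than `(n - 1 - φ v) / p`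
times, so the ratio is at most `p`. Finitely many 0-1 markings suffice, so the minimum exists and
equals the infimum. -/

namespace TokenGame

variable {V : Type*}

/-- The state of the token game after `n` time pulses. -/
noncomputable def stateAt (G : SimpleGraph V) (c T : V → V → ℕ) (n : ℕ) : State V :=
  (State.next G c)^[n] (initialState T)

open Classical in
/-- The number of times that `u` fires during the first `n` time pulses. -/
noncomputable def firings (G : SimpleGraph V) (c T : V → V → ℕ) (u : V) (n : ℕ) : ℕ :=
  ∑ i ∈ Finset.range n, if (stateAt G c T i).Fireable G u then 1 else 0

/-! ### Firing counts and token conservation -/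

section Counting

variable {G : SimpleGraph V} {c T : V → V → ℕ}

theorem stateAt_succ (n : ℕ) : stateAt G c T (n + 1) = (stateAt G c T n).next G c :=
  Function.iterate_succ_apply' _ _ _

theorem mem_fireSet_succ {n : ℕ} {u : V} :
    u ∈ fireSet G c T (n + 1) ↔ (stateAt G c T n).Fireable G u := Iff.rfl

@[simp]
theorem firings_zero (u : V) : firings G c T u 0 = 0 := by simp [firings]

open Classical in
theorem firings_succ (u : V) (n : ℕ) : firings G c T u (n + 1) =
    firings G c T u n + if (stateAt G c T n).Fireable G u then 1 else 0 :=
  Finset.sum_range_succ _ _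

theorem firings_mono (u : V) : Monotone (firings G c T u) :=
  monotone_nat_of_le_succ fun n => by rw [firings_succ]; omega

theorem firings_succ_le (u : V) (n : ℕ) : firings G c T u (n + 1) ≤ firings G c T u n + 1 := by
  rw [firings_succ]; split_ifs <;> omega

/-- A token due at state `n + k + 1` stems from a firing in state `n + k + 1 - c u v`. The cap at
`n` excludes firings still to come; truncated subtraction handles those before the start. -/
theorem transit_add_firings (u v : V) (n k : ℕ) :
    (stateAt G c T n).transit u v k + firings G c T u (min (n + k + 1 - c u v) n) =
      firings G c T u (min (n + k + 2 - c u v) n) := by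
  induction n generalizing k with
  | zero => simp [stateAt, initialState]
  | succ n ih =>
    have h := ih (k + 1)
    rw [stateAt_succ]
    simp only [State.next, State.enRoute]
    rcases lt_trichotomy (c u v) (k + 2) with hlt | heq | hgt
    · rw [show min (n + (k + 1) + 1 - c u v) n = n by omega,
        show min (n + (k + 1) + 2 - c u v) n = n by omega] at h
      rw [show min (n + 1 + k + 1 - c u v) (n + 1) = n + 1 by omega,
        show min (n + 1 + k + 2 - c u v) (n + 1) = n + 1 by omega, if_neg (by omega)]
      omega
    · rw [show min (n + (k + 1) + 1 - c u v) n = n by omega,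
        show min (n + (k + 1) + 2 - c u v) n = n by omega] at h
      rw [show min (n + 1 + k + 1 - c u v) (n + 1) = n by omega,
        show min (n + 1 + k + 2 - c u v) (n + 1) = n + 1 by omega, firings_succ]
      by_cases hu : (stateAt G c T n).Fireable G u
      · rw [if_pos ⟨hu, heq⟩, if_pos hu]
        omega
      · rw [if_neg fun h => hu h.1, if_neg hu]
        omega
    · rw [show min (n + (k + 1) + 1 - c u v) n = n + k + 2 - c u v by omega,
        show min (n + (k + 1) + 2 - c u v) n = n + k + 3 - c u v by omega] at h
      rw [show min (n + 1 + k + 1 - c u v) (n + 1) = n + k + 2 - c u v by omega,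
        show min (n + 1 + k + 2 - c u v) (n + 1) = n + k + 3 - c u v by omega, if_neg (by omega)]
      omega

theorem transit_le_one (u v : V) (n k : ℕ) : (stateAt G c T n).transit u v k ≤ 1 := by
  have h := transit_add_firings (G := G) (c := c) (T := T) u v n k
  have h₁ := firings_succ_le (G := G) (c := c) (T := T) u (min (n + k + 1 - c u v) n)
  have h₂ : firings G c T u (min (n + k + 2 - c u v) n) ≤
      firings G c T u (min (n + k + 1 - c u v) n + 1) := firings_mono u (by omega)
  omega

theorem transit_eq_zero {u v : V} {k : ℕ} (hk : c u v ≤ k) (n : ℕ) :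
    (stateAt G c T n).transit u v k = 0 := by
  have h := transit_add_firings (G := G) (c := c) (T := T) u v n k
  rw [show min (n + k + 1 - c u v) n = n by omega,
    show min (n + k + 2 - c u v) n = n by omega] at h
  omega

/-- The tokens on an arc are those placed there so far without those removed so far. -/
theorem tokens_add_firings {u v : V} (huv : G.Adj u v) (hc : 0 < c u v) (n : ℕ) :
    (stateAt G c T n).tokens u v + firings G c T v n =
      T u v + firings G c T u (n + 1 - c u v) := by
  induction n with
  | zero => rw [show 0 + 1 - c u v = 0 by omega]; simp [stateAt, initialState]
  | succ n ih =>
    have h := transit_add_firings (G := G) (c := c) (T := T) u v n 0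
    have hpos : (stateAt G c T n).Fireable G v → 0 < (stateAt G c T n).tokens u v :=
      fun hv => hv u huv
    rw [firings_succ v, stateAt_succ]
    simp only [State.next]
    have key : (stateAt G c T n).enRoute G c u v 0 + firings G c T u (n + 1 - c u v) =
        firings G c T u (n + 1 + 1 - c u v) := by
      rw [State.enRoute]
      rcases (show c u v = 1 ∨ 2 ≤ c u v by omega) with h1 | h2
      · rw [show min (n + 0 + 1 - c u v) n = n by omega,
          show min (n + 0 + 2 - c u v) n = n by omega] at h
        rw [show n + 1 - c u v = n by omega, show n + 1 + 1 - c u v = n + 1 by omega, firings_succ]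
        by_cases hu : (stateAt G c T n).Fireable G u
        · rw [if_pos ⟨hu, h1⟩, if_pos hu]
          omega
        · rw [if_neg fun h => hu h.1, if_neg hu]
          omega
      · rw [show min (n + 0 + 1 - c u v) n = n + 1 - c u v by omega,
          show min (n + 0 + 2 - c u v) n = n + 2 - c u v by omega] at h
        rw [if_neg (by omega), show n + 1 + 1 - c u v = n + 2 - c u v by omega]
        omega
    by_cases hv : (stateAt G c T n).Fireable G v
    · have := hpos hv
      rw [if_pos hv]
      omega
    · rw [if_neg hv]
      omega

theorem firings_succ_le_add {u v : V} (huv : G.Adj u v) (hc : 0 < c u v) (n : ℕ) :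
    firings G c T v (n + 1) ≤ T u v + firings G c T u (n + 1 - c u v) := by
  have h := tokens_add_firings (T := T) huv hc n
  rw [firings_succ]
  split_ifs with hv
  · have := hv u huv
    omega
  · omega

/-- An idle vertex has an empty in-arc, on which token conservation becomes an equality. -/
theorem exists_add_firings_eq_of_not_fireable (hc : ∀ u v, G.Adj u v → 0 < c u v) {v : V} {n : ℕ}
    (h : ¬ (stateAt G c T n).Fireable G v) :
    ∃ u, G.Adj u v ∧ firings G c T v n = T u v + firings G c T u (n + 1 - c u v) := by
  simp only [State.Fireable, not_forall, not_lt, nonpos_iff_eq_zero] at h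
  obtain ⟨u, huv, h0⟩ := h
  have := tokens_add_firings (T := T) huv (hc u v huv) n
  exact ⟨u, huv, by omega⟩

theorem firings_le_add {u v : V} (huv : G.Adj u v) (hc : 0 < c u v) (n : ℕ) :
    firings G c T v n ≤ T u v + firings G c T u n := by
  have h := tokens_add_firings (T := T) huv hc n
  have := firings_mono (G := G) (c := c) (T := T) u (show n + 1 - c u v ≤ n by omega)
  omega

/-- Conservation on `uv` and the bound along `vu` leave at most `T u v + T v u = 1`. -/
theorem tokens_le_one (hT : IsGood G T) (hc : ∀ u v, G.Adj u v → 0 < c u v) {u v : V}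
    (huv : G.Adj u v) (n : ℕ) : (stateAt G c T n).tokens u v ≤ 1 := by
  have h := tokens_add_firings (T := T) huv (hc u v huv) n
  have := firings_mono (G := G) (c := c) (T := T) u (show n + 1 - c u v ≤ n by
    have := hc u v huv
    omega)
  have := firings_le_add (T := T) huv.symm (hc v u huv.symm) n
  have := hT.2 u v huv
  omega

end Counting

/-! ### Eventual periodicity and equal multiplicities -/

section Periodicity

variable {G : SimpleGraph V} {c T : V → V → ℕ}

/-- Two states that agree on the arcs. -/
def State.AgreeOn (G : SimpleGraph V) (s s' : State V) : Prop :=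
  ∀ u v, G.Adj u v → s.tokens u v = s'.tokens u v ∧ ∀ k, s.transit u v k = s'.transit u v k

theorem State.AgreeOn.fireable_iff {s s' : State V} (h : s.AgreeOn G s') (v : V) :
    s.Fireable G v ↔ s'.Fireable G v :=
  forall₂_congr fun u huv => by rw [(h u v huv).1]

theorem State.AgreeOn.next {s s' : State V} (h : s.AgreeOn G s') :
    (s.next G c).AgreeOn G (s'.next G c) := by
  intro u v huv
  obtain ⟨h₁, h₂⟩ := h u v huv
  have hfire : s.Fireable G = s'.Fireable G := funext fun w => propext (h.fireable_iff w)
  have hroute : ∀ k, s.enRoute G c u v k = s'.enRoute G c u v k := fun k => by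
    unfold State.enRoute
    congr 1
    · exact h₂ k
    · rw [hfire]
  refine ⟨?_, fun k => hroute (k + 1)⟩
  simp only [State.next, h₁, hroute]
  rw [hfire]

/-- The game is eventually periodic, since on the arcs it runs through finitely many states. -/
theorem exists_isPeriodicFrom [Finite V] (hc : ∀ u v, G.Adj u v → 0 < c u v) (hT : IsGood G T) :
    ∃ p M, IsPeriodicFrom G c T p M := by
  obtain ⟨K, hK⟩ : ∃ K, ∀ u v, c u v ≤ K := by
    obtain ⟨K, hK⟩ := (Set.finite_range fun a : V × V => c a.1 a.2).bddAbove
    exact ⟨K, fun u v => hK ⟨(u, v), rfl⟩⟩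
  -- On arcs all entries are 0 or 1, so positivity determines them, and transit entries from `K` on
  -- vanish. Off the arcs tokens may accumulate, hence the mask `G.Adj u v`.
  let code : ℕ → V → V → Prop × (Fin K → Prop) := fun n u v =>
    (0 < (stateAt G c T n).tokens u v ∧ G.Adj u v,
      fun k => 0 < (stateAt G c T n).transit u v k)
  obtain ⟨i, j, hij, hcode⟩ : ∃ i j, i < j ∧ code i = code j := by
    obtain ⟨i, j, hne, h⟩ := Finite.exists_ne_map_eq_of_infinite code
    rcases hne.lt_or_gt with hlt | hlt
    · exact ⟨i, j, hlt, h⟩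
    · exact ⟨j, i, hlt, h.symm⟩
  have hagree : ∀ n, (stateAt G c T (j + n)).AgreeOn G (stateAt G c T (i + n)) := by
    intro n
    induction n with
    | zero =>
      intro u v huv
      have h := congrFun (congrFun hcode u) v
      simp only [code, Prod.mk.injEq, huv, and_true, eq_iff_iff] at h
      refine ⟨?_, fun k => ?_⟩
      · have := tokens_le_one hT hc huv i
        have := tokens_le_one hT hc huv j
        have := h.1
        simp only [add_zero]
        omega
      · simp only [add_zero]
        rcases lt_or_ge k K with hk | hk
        · have h2 := iff_of_eq (congrFun h.2 ⟨k, hk⟩)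
          have := transit_le_one (G := G) (c := c) (T := T) u v i k
          have := transit_le_one (G := G) (c := c) (T := T) u v j k
          dsimp only at h2
          omega
        · rw [transit_eq_zero ((hK u v).trans hk), transit_eq_zero ((hK u v).trans hk)]
    | succ n ih =>
      rw [← add_assoc, ← add_assoc, stateAt_succ, stateAt_succ]
      exact ih.next
  refine ⟨j - i, i + 1, by omega, by omega, fun t ht => ?_⟩
  obtain ⟨n, rfl⟩ := Nat.exists_eq_add_of_le ht
  ext v
  rw [show i + 1 + n + (j - i) = j + n + 1 by omega, show i + 1 + n = i + n + 1 by omega,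
    mem_fireSet_succ, mem_fireSet_succ]
  exact (hagree n).fireable_iff v

theorem isPeriodicFrom_period_steadyTime (h : ∃ p M, IsPeriodicFrom G c T p M) :
    IsPeriodicFrom G c T (period G c T) (steadyTime G c T) := by
  have hp : ∃ M, IsPeriodicFrom G c T (period G c T) M := Nat.sInf_mem h
  exact Nat.sInf_mem (s := {M | IsPeriodicFrom G c T (period G c T) M}) hp

/-- From some time on, every period adds the multiplicity to the number of firings. -/
theorem exists_firings_add_period (h : ∃ p M, IsPeriodicFrom G c T p M) :
    ∃ n₀, ∀ u n, n₀ ≤ n →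
      firings G c T u (n + period G c T) = firings G c T u n + multiplicity G c T u := by
  classical
  obtain ⟨-, hM, hper⟩ := isPeriodicFrom_period_steadyTime h
  -- Time pulse `t` reads the state of index `t - 1`.
  obtain ⟨n₀, hn₀⟩ : ∃ n₀, steadyTime G c T = n₀ + 1 := ⟨steadyTime G c T - 1, by omega⟩
  refine ⟨n₀, fun u n hn => ?_⟩
  induction n, hn using Nat.le_induction with
  | base =>
    rw [multiplicity, Finset.card_filter, Finset.sum_Ico_eq_sum_range, firings,
      Finset.sum_range_add, ← firings, Nat.add_sub_cancel_left, hn₀]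
    congr 1
    refine Finset.sum_congr rfl fun i _ => ?_
    simp only [show n₀ + 1 + i = n₀ + i + 1 by omega, mem_fireSet_succ]
  | succ n hn ih =>
    have hfire : (stateAt G c T (n + period G c T)).Fireable G u ↔
        (stateAt G c T n).Fireable G u := by
      have := hper (n + 1) (by omega)
      rw [← mem_fireSet_succ, ← mem_fireSet_succ, ← this, Nat.add_right_comm]
    rw [Nat.add_right_comm, firings_succ, firings_succ, ih]
    simp only [hfire]
    omega

theorem apply_add_mul_of_add_eq {f : ℕ → ℕ} {n₀ p m : ℕ} (h : ∀ n, n₀ ≤ n → f (n + p) = f n + m)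
    (j : ℕ) : f (n₀ + j * p) = f n₀ + j * m := by
  induction j with
  | zero => simp
  | succ j ih =>
    rw [add_mul, add_mul, one_mul, one_mul, ← add_assoc, h _ (by omega), ih]
    omega

/-- The lead of `v` over `u` never exceeds `T u v`, so `v` cannot gain on `u` in every period. -/
theorem multiplicity_le_of_adj (hc : ∀ u v, G.Adj u v → 0 < c u v)
    (h : ∃ p M, IsPeriodicFrom G c T p M) {u v : V} (huv : G.Adj u v) :
    multiplicity G c T v ≤ multiplicity G c T u := by
  obtain ⟨n₀, hn₀⟩ := exists_firings_add_period h
  by_contra! hlt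
  set j := T u v + firings G c T u n₀ + 1 with hj
  have h₁ := firings_le_add (T := T) huv (hc u v huv) (n₀ + j * period G c T)
  rw [apply_add_mul_of_add_eq (hn₀ u), apply_add_mul_of_add_eq (hn₀ v)] at h₁
  have h₂ : j * (multiplicity G c T u + 1) ≤ j * multiplicity G c T v :=
    Nat.mul_le_mul_left j hlt
  rw [mul_add, mul_one] at h₂
  omega

theorem multiplicity_eq (hG : G.Connected) (hc : ∀ u v, G.Adj u v → 0 < c u v)
    (h : ∃ p M, IsPeriodicFrom G c T p M) (u v : V) :
    multiplicity G c T u = multiplicity G c T v := by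
  obtain ⟨w⟩ := hG.preconnected u v
  induction w with
  | nil => rfl
  | cons huv _ ih =>
    exact ((multiplicity_le_of_adj hc h huv.symm).antisymm
      (multiplicity_le_of_adj hc h huv)).trans ih

end Periodicity

/-! ### No deadlock -/

section Liveness

variable {G : SimpleGraph V}

/-- The walk to `x` along which the iterates of `f` at `x` are met in reverse order. -/
def iterateWalk {f : V → V} (hf : ∀ v, G.Adj (f v) v) (x : V) : ∀ n, G.Walk (f^[n] x) x
  | 0 => SimpleGraph.Walk.nil
  | n + 1 => SimpleGraph.Walk.cons
      (by rw [Function.iterate_succ_apply']; exact hf _) (iterateWalk hf x n)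

theorem length_iterateWalk {f : V → V} (hf : ∀ v, G.Adj (f v) v) (x : V) (n : ℕ) :
    (iterateWalk hf x n).length = n := by
  induction n with
  | zero => rfl
  | succ n ih => rw [iterateWalk, SimpleGraph.Walk.length_cons, ih]

theorem support_iterateWalk {f : V → V} (hf : ∀ v, G.Adj (f v) v) (x : V) (n : ℕ) :
    (iterateWalk hf x n).support = ((List.range (n + 1)).map fun i => f^[i] x).reverse := by
  induction n with
  | zero => rfl
  | succ n ih =>
    rw [List.range_succ, List.map_append, List.reverse_append, iterateWalk,
      SimpleGraph.Walk.support_cons, ih]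
    rfl

theorem tokenCount_iterateWalk {T : V → V → ℕ} {f : V → V} (hf : ∀ v, G.Adj (f v) v) {N : V → ℕ}
    (hN : ∀ v, N v = T (f v) v + N (f v)) (x : V) (n : ℕ) :
    tokenCount T (iterateWalk hf x n) + N (f^[n] x) = N x := by
  induction n with
  | zero => simp [iterateWalk, tokenCount]
  | succ n ih =>
    have h := hN (f^[n] x)
    rw [← Function.iterate_succ_apply' f n x, Nat.succ_eq_add_one] at h
    simp only [tokenCount, iterateWalk, SimpleGraph.Walk.darts_cons, List.map_cons,
      List.sum_cons] at ih ⊢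
    omega

/-- Tracing blocking in-neighbours backwards closes up in a directed cycle, around which `N`
telescopes, leaving no token on it. -/
theorem IsGood.not_forall_exists_blocked [Finite V] [Nonempty V] {T : V → V → ℕ} (hT : IsGood G T)
    (N : V → ℕ) : ¬ ∀ v, ∃ u, G.Adj u v ∧ N v = T u v + N u := by
  intro h
  choose f hf hN using h
  obtain ⟨x, n, hn, hx⟩ : ∃ x n, 0 < n ∧ Function.IsPeriodicPt f n x := by
    obtain ⟨i, j, hne, h⟩ :=
      Finite.exists_ne_map_eq_of_infinite fun n => f^[n] (Classical.arbitrary V)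
    wlog hlt : i < j generalizing i j
    · exact this j i hne.symm h.symm (by omega)
    refine ⟨f^[i] (Classical.arbitrary V), j - i, by omega, ?_⟩
    rw [Function.IsPeriodicPt, Function.IsFixedPt, ← Function.iterate_add_apply,
      Nat.sub_add_cancel hlt.le]
    exact h.symm
  -- Minimality keeps the vertices of the closed walk distinct.
  set m := Function.minimalPeriod f x
  have hm : 0 < m := hx.minimalPeriod_pos hn
  have hfix : f^[m] x = x := Function.isPeriodicPt_minimalPeriod f x
  let C : G.Walk x x := (iterateWalk hf x m).copy hfix rfl
  have hC : IsDicycle C := by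
    refine ⟨by simpa [C, length_iterateWalk] using hm, ?_⟩
    simp only [C, SimpleGraph.Walk.support_copy, support_iterateWalk, List.range_succ,
      List.map_append, List.reverse_append, List.map_cons, List.map_nil, List.reverse_cons,
      List.reverse_nil, List.nil_append, List.singleton_append, List.tail_cons,
      List.nodup_reverse]
    refine List.Nodup.map_on (fun i hi j hj hij => ?_) List.nodup_range
    exact Function.iterate_injOn_Iio_minimalPeriod (List.mem_range.1 hi) (List.mem_range.1 hj) hij
  have hpos := hT.1 x C hC
  have hcount := tokenCount_iterateWalk hf hN x m
  have hNx : N (f^[m] x) = N x := congrArg N hfix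
  simp only [C, tokenCount, SimpleGraph.Walk.darts_copy] at hpos hcount
  omega

theorem multiplicity_pos [Finite V] (hG : G.Connected) {c T : V → V → ℕ}
    (hc : ∀ u v, G.Adj u v → 0 < c u v) (hT : IsGood G T) (u : V) :
    0 < multiplicity G c T u := by
  have hper := exists_isPeriodicFrom hc hT
  by_contra! h0
  have hzero : ∀ v, multiplicity G c T v = 0 := fun v => by
    rw [multiplicity_eq hG hc hper v u]
    omega
  obtain ⟨n₀, hn₀⟩ := exists_firings_add_period hper
  have hp : 0 < period G c T := (isPeriodicFrom_period_steadyTime hper).1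
  have hconst : ∀ v n, n₀ ≤ n → firings G c T v n = firings G c T v n₀ := by
    intro v n hn
    refine le_antisymm ?_ (firings_mono v hn)
    have h := apply_add_mul_of_add_eq (hn₀ v) n
    rw [hzero v, mul_zero, add_zero] at h
    rw [← h]
    exact firings_mono v ((Nat.le_mul_of_pos_right n hp).trans (Nat.le_add_left _ _))
  obtain ⟨K, hK⟩ := (Set.finite_range fun a : V × V => c a.1 a.2).bddAbove
  have : Nonempty V := ⟨u⟩
  refine hT.not_forall_exists_blocked (fun v => firings G c T v n₀) fun v => ?_
  -- After `K` further pulses the delayed counts have also reached their final values.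
  have hnot : ¬ (stateAt G c T (n₀ + K)).Fireable G v := by
    intro hv
    have h := firings_succ (G := G) (c := c) (T := T) v (n₀ + K)
    rw [if_pos hv, hconst v (n₀ + K + 1) (by omega), hconst v (n₀ + K) (by omega)] at h
    omega
  obtain ⟨w, hwv, hw⟩ := exists_add_firings_eq_of_not_fireable hc hnot
  have hcK : c w v ≤ K := hK ⟨(w, v), rfl⟩
  rw [hconst v _ (by omega), hconst w _ (by omega)] at hw
  exact ⟨w, hwv, hw⟩

end Liveness

/-! ### From markings to colorings -/

section Coloring

variable {G : SimpleGraph V} {c : V → V → ℕ}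

/-- A potential with `y u + c u v ≤ y v + r * T u v` on the arcs, reduced modulo `r`, is a
circular `r`-coloring. -/
theorem exists_isCircularColoring_of_potential {T : V → V → ℕ}
    (hc : ∀ u v, G.Adj u v → 0 < c u v) (hT : ∀ u v, G.Adj u v → T u v + T v u = 1) {r : ℝ}
    (hr : 0 < r) (y : V → ℝ) (hy : ∀ u v, G.Adj u v → y u + c u v ≤ y v + r * T u v) :
    ∃ φ : V → ℝ, IsCircularColoring G (fun a b => (c a b : ℝ)) r φ := by
  refine ⟨fun v => toIcoMod hr 0 (y v), fun v => ?_, fun u v huv => ?_⟩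
  · simpa using toIcoMod_mem_Ico hr 0 (y v)
  have h₁ := hy u v huv
  have h₂ := hy v u huv.symm
  have hvu : (0 : ℝ) < c v u := by exact_mod_cast hc v u huv.symm
  have huv' : (0 : ℝ) < c u v := by exact_mod_cast hc u v huv
  have hTsum : (T u v : ℝ) + T v u = 1 := by exact_mod_cast hT u v huv
  have hTvu : (T v u : ℝ) = 1 - T u v := by linarith
  rw [hTvu] at h₂
  change (c u v : ℝ) ≤ circDist r (toIcoMod hr 0 (y u)) (toIcoMod hr 0 (y v))
  have mu := toIcoMod_mem_Ico hr 0 (y u)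
  have mv := toIcoMod_mem_Ico hr 0 (y v)
  have eu := self_sub_toIcoDiv_zsmul hr 0 (y u)
  have ev := self_sub_toIcoDiv_zsmul hr 0 (y v)
  simp only [zero_add, Set.mem_Ico, zsmul_eq_mul] at mu mv eu ev
  generalize toIcoMod hr 0 (y u) = a at *
  generalize toIcoMod hr 0 (y v) = b at *
  generalize toIcoDiv hr 0 (y u) = k at *
  generalize toIcoDiv hr 0 (y v) = l at *
  -- `b - a` differs from a number in `[c u v, r - c v u]` by a multiple of `r`
  obtain ⟨z, hz⟩ : ∃ z : ℤ, b - a = y v - y u + r * T u v + z * r :=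
    ⟨k - l - T u v, by push_cast; linarith⟩
  have hz₁ : z < 1 := by
    by_contra! hge
    have : (1 : ℝ) ≤ z := by exact_mod_cast hge
    nlinarith
  unfold circDist
  split_ifs with hab
  · have hz₂ : -1 < z := by
      by_contra! hle
      have : (z : ℝ) ≤ -1 := by exact_mod_cast hle
      nlinarith
    obtain rfl : z = 0 := by omega
    push_cast at hz
    linarith
  · have hz₂ : -2 < z := by
      by_contra! hle
      have : (z : ℝ) ≤ -2 := by exact_mod_cast hle
      nlinarith
    -- Here the distance is `r + (b - a)`, so `z ≥ -1` is enough.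
    have hz₃ : (-1 : ℝ) ≤ z := by exact_mod_cast (show -1 ≤ z by omega)
    nlinarith

/-- Moving the window by one replaces a term by the one `p` later, a gain of `m`. -/
theorem sum_range_add_of_add_eq {f : ℕ → ℕ} {n₀ p m : ℕ} (h : ∀ n, n₀ ≤ n → f (n + p) = f n + m)
    (k : ℕ) : ∑ i ∈ Finset.range p, f (n₀ + k + i) =
      ∑ i ∈ Finset.range p, f (n₀ + i) + k * m := by
  induction k with
  | zero => simp
  | succ k ih =>
    have h₁ := Finset.sum_range_succ (fun i => f (n₀ + k + i)) p
    rw [Finset.sum_range_succ', h _ (by omega), ih, add_zero] at h₁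
    simp only [show ∀ i, n₀ + k + (i + 1) = n₀ + (k + 1) + i from fun i => by omega] at h₁
    rw [add_mul, one_mul]
    omega

/-- Averaging the firings over a period yields a potential, hence a coloring. -/
theorem exists_isCircularColoring_period_div_multiplicity [Finite V] (hG : G.Connected)
    (hc : ∀ u v, G.Adj u v → 0 < c u v) {T : V → V → ℕ} (hT : IsGood G T) (w : V) :
    0 < (period G c T : ℝ) / multiplicity G c T w ∧
    ∃ φ : V → ℝ, IsCircularColoring G (fun a b => (c a b : ℝ))
      ((period G c T : ℝ) / multiplicity G c T w) φ := by
  have hper := exists_isPeriodicFrom hc hT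
  obtain ⟨n₀, hn₀⟩ := exists_firings_add_period hper
  have hm : (0 : ℝ) < multiplicity G c T w := by exact_mod_cast multiplicity_pos hG hc hT w
  have hp : (0 : ℝ) < period G c T := by
    exact_mod_cast (isPeriodicFrom_period_steadyTime hper).1
  refine ⟨div_pos hp hm, ?_⟩
  let S : V → ℕ := fun v => ∑ i ∈ Finset.range (period G c T), firings G c T v (n₀ + i)
  -- The sign is negative because a vertex with more firings is ahead, hence earlier on the circle.
  refine exists_isCircularColoring_of_potential hc hT.2 (div_pos hp hm)
    (fun v => -(S v : ℝ) / multiplicity G c T w) fun u v huv => ?_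
  -- The arc inequality is summed over one period; the delay `c u v` becomes a shift of the window.
  have key : S v + c u v * multiplicity G c T w ≤ period G c T * T u v + S u := by
    rw [multiplicity_eq hG hc hper w v, ← sum_range_add_of_add_eq (hn₀ v) (c u v)]
    calc ∑ i ∈ Finset.range (period G c T), firings G c T v (n₀ + c u v + i)
        ≤ ∑ i ∈ Finset.range (period G c T), (T u v + firings G c T u (n₀ + i)) := by
          refine Finset.sum_le_sum fun i _ => ?_
          have hpos := hc u v huv
          have h := firings_succ_le_add (T := T) huv hpos (n₀ + c u v + i - 1)
          rwa [show n₀ + c u v + i - 1 + 1 = n₀ + c u v + i by omega,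
            show n₀ + c u v + i - c u v = n₀ + i by omega] at h
      _ = period G c T * T u v + S u := by
          rw [Finset.sum_add_distrib, Finset.sum_const, Finset.card_range, smul_eq_mul]
  have key' : (S v : ℝ) + c u v * multiplicity G c T w ≤ period G c T * T u v + S u := by
    exact_mod_cast key
  rw [← sub_nonneg]
  have : -(S v : ℝ) / multiplicity G c T w + period G c T / multiplicity G c T w * T u v -
      (-(S u : ℝ) / multiplicity G c T w + c u v) =
      (period G c T * T u v + S u - (S v + c u v * multiplicity G c T w)) /
        multiplicity G c T w := by
    field_simp
    ring
  rw [this]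
  exact div_nonneg (sub_nonneg.2 key') hm.le

/-! ### From colorings to markings -/

open Classical in
/-- The marking of a coloring has its tokens on the arcs that pass the origin of the circle. -/
noncomputable def coloringMarking (φ : V → ℝ) (u v : V) : ℕ := if φ v < φ u then 1 else 0

theorem coloringMarking_le_one (φ : V → ℝ) (u v : V) : coloringMarking φ u v ≤ 1 := by
  unfold coloringMarking; split_ifs <;> omega

variable {p : ℝ} {φ : V → ℝ}

theorem IsCircularColoring.add_le
    (hφ : IsCircularColoring G (fun a b => (c a b : ℝ)) p φ) {u v : V} (huv : G.Adj u v) :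
    φ u + c u v ≤ φ v + p * coloringMarking φ u v := by
  have h := hφ.2 u v huv
  unfold circDist at h
  unfold coloringMarking
  split_ifs at h ⊢ with h₁ h₂ <;> push_cast <;> linarith

/-- Since weights are positive, `φ` strictly increases along token-free arcs, so no directed cycle
consists of them. -/
theorem IsCircularColoring.isGood (hc : ∀ u v, G.Adj u v → 0 < c u v)
    (hφ : IsCircularColoring G (fun a b => (c a b : ℝ)) p φ) : IsGood G (coloringMarking φ) := by
  have hlt : ∀ {u v}, G.Adj u v → coloringMarking φ u v = 0 → φ u < φ v := by
    intro u v huv h0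
    have h := hφ.add_le huv
    have hpos : (0 : ℝ) < c u v := by exact_mod_cast hc u v huv
    rw [h0] at h
    push_cast at h
    linarith
  refine ⟨fun u C hC => ?_, fun u v huv => ?_⟩
  · have hle : ∀ {a b : V} (w : G.Walk a b), tokenCount (coloringMarking φ) w = 0 →
        φ a ≤ φ b ∧ (0 < w.length → φ a < φ b) := by
      intro a b w
      induction w with
      | nil => simp
      | cons hab w ih =>
        intro h
        simp only [tokenCount, SimpleGraph.Walk.darts_cons, List.map_cons, List.sum_cons,
          Nat.add_eq_zero_iff] at h ih
        have h₁ := (hlt hab h.1).trans_le (ih h.2).1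
        exact ⟨h₁.le, fun _ => h₁⟩
    by_contra! h0
    exact lt_irrefl _ ((hle C (by omega)).2 hC.1)
  · rcases lt_trichotomy (φ u) (φ v) with h | h | h
    · simp [coloringMarking, h, h.not_gt]
    · have := hlt huv (by simp [coloringMarking, h])
      exact absurd this (by simp [h])
    · simp [coloringMarking, h, h.not_gt]

theorem IsCircularColoring.one_le (hc : ∀ u v, G.Adj u v → 0 < c u v)
    (hφ : IsCircularColoring G (fun a b => (c a b : ℝ)) p φ) {u v : V} (huv : G.Adj u v) :
    1 ≤ p := by
  have h := hφ.2 u v huv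
  have hpos : (1 : ℝ) ≤ c u v := by exact_mod_cast hc u v huv
  have hu := hφ.1 u
  have hv := hφ.1 v
  rw [Set.mem_Ico] at hu hv
  unfold circDist at h
  split_ifs at h <;> linarith

/-- Under the marking of a `p`-coloring every vertex `v` fires at least as often as at the times
`1 + φ v + k * p`. -/
theorem IsCircularColoring.lt_mul_firings (hc : ∀ u v, G.Adj u v → 0 < c u v)
    (hφ : IsCircularColoring G (fun a b => (c a b : ℝ)) p φ) (hp : 1 ≤ p) (n : ℕ) (v : V) :
    (n : ℝ) - 1 - φ v < p * firings G c (coloringMarking φ) v n := by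
  induction n using Nat.strong_induction_on generalizing v with
  | _ n ih =>
    rcases n with _ | n
    · have := (hφ.1 v).1
      simp only [firings_zero, Nat.cast_zero, mul_zero]
      linarith
    · by_cases hv : (stateAt G c (coloringMarking φ) n).Fireable G v
      -- A firing raises the right side by `p ≥ 1`, the left side by 1.
      · have := ih n (by omega) v
        rw [firings_succ, if_pos hv]
        push_cast
        linarith
      · obtain ⟨u, huv, hu⟩ := exists_add_firings_eq_of_not_fireable hc hv
        have hadd := hφ.add_le huv
        have hpos := hc u v huv
        rw [firings_succ, if_neg hv, add_zero, hu]
        push_cast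
        rcases le_or_gt (c u v) (n + 1) with hle | hgt
        · have h := ih (n + 1 - c u v) (by omega) u
          push_cast [Nat.cast_sub hle] at h
          linarith
        -- No token from `u` can have arrived yet; `c u v > n + 1` alone gives the bound.
        · rw [show n + 1 - c u v = 0 by omega, firings_zero]
          have : (n : ℝ) + 1 < c u v := by exact_mod_cast hgt
          have := (hφ.1 u).1
          push_cast
          linarith

theorem IsCircularColoring.period_div_multiplicity_le [Finite V] [Nontrivial V] (hG : G.Connected)
    (hc : ∀ u v, G.Adj u v → 0 < c u v)
    (hφ : IsCircularColoring G (fun a b => (c a b : ℝ)) p φ) (w : V) :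
    (period G c (coloringMarking φ) : ℝ) / multiplicity G c (coloringMarking φ) w ≤ p := by
  have hT := hφ.isGood hc
  obtain ⟨n₀, hn₀⟩ := exists_firings_add_period (exists_isPeriodicFrom hc hT)
  have hm : (0 : ℝ) < multiplicity G c (coloringMarking φ) w := by
    exact_mod_cast multiplicity_pos hG hc hT w
  obtain ⟨x, hx⟩ := hG.preconnected.exists_adj_of_nontrivial w
  have hp := hφ.one_le hc hx
  rw [div_le_iff₀ hm]
  by_contra! hlt
  -- If the ratio exceeded `p`, the linear lower bound on firings would outgrow the actual count
  -- after `j` periods.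
  obtain ⟨j, hj⟩ := exists_nat_gt
    ((p * firings G c (coloringMarking φ) w n₀ + 1 + φ w) /
      (period G c (coloringMarking φ) - p * multiplicity G c (coloringMarking φ) w))
  rw [div_lt_iff₀ (sub_pos.2 hlt)] at hj
  have h := hφ.lt_mul_firings hc hp (n₀ + j * period G c (coloringMarking φ)) w
  rw [apply_add_mul_of_add_eq (hn₀ w)] at h
  push_cast at h
  have : (0 : ℝ) ≤ n₀ := Nat.cast_nonneg _
  linarith

/-- Distinct multiples of `K + 1` keep all gaps, also the one across the origin, above every weight.
-/
theorem exists_isCircularColoring [Finite V] [Nonempty V] (G : SimpleGraph V) (c : V → V → ℕ) :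
    ∃ p : ℝ, 0 < p ∧ ∃ φ : V → ℝ, IsCircularColoring G (fun a b => (c a b : ℝ)) p φ := by
  obtain ⟨K, hK⟩ := (Set.finite_range fun a : V × V => c a.1 a.2).bddAbove
  obtain ⟨n, ⟨e⟩⟩ := Finite.exists_equiv_fin V
  have hn : (0 : ℝ) < n := by exact_mod_cast (e (Classical.arbitrary V)).pos
  have hK₀ : (0 : ℝ) < K + 1 := by positivity
  refine ⟨(K + 1) * n, by positivity, fun v => (K + 1) * (e v : ℕ), fun v => ⟨by positivity, ?_⟩,
    fun u v huv => ?_⟩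
  · have : ((e v : ℕ) : ℝ) < n := by exact_mod_cast (e v).2
    exact mul_lt_mul_of_pos_left this hK₀
  · have hcK : (c u v : ℝ) ≤ K := by exact_mod_cast hK ⟨(u, v), rfl⟩
    have hne : (e u : ℕ) ≠ e v := fun h => huv.ne (e.injective (Fin.ext h))
    have hu : ((e u : ℕ) : ℝ) + 1 ≤ n := by exact_mod_cast (e u).2
    have hv : (0 : ℝ) ≤ (e v : ℕ) := Nat.cast_nonneg _
    unfold circDist
    split_ifs with h
    · have h₁ : (e u : ℕ) ≤ e v := by exact_mod_cast le_of_mul_le_mul_left h hK₀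
      have h₂ : ((e u : ℕ) : ℝ) + 1 ≤ (e v : ℕ) := by
        exact_mod_cast (show (e u : ℕ) + 1 ≤ e v by omega)
      nlinarith
    · nlinarith

end Coloring

end TokenGame

/-- The first two conjuncts say that the period and the multiplicity are well defined: the token
game is eventually periodic, and the multiplicity is positive and the same for all vertices. -/
theorem theorem6 {V : Type*} [Finite V] [Nontrivial V] (G : SimpleGraph V) (hG : G.Connected)
    (c : V → V → ℕ) (hc : ∀ u v, G.Adj u v → 0 < c u v) :
    (∀ T, TokenGame.IsGood G T → ∃ p M, TokenGame.IsPeriodicFrom G c T p M) ∧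
    (∀ T, TokenGame.IsGood G T → ∀ u v, 0 < TokenGame.multiplicity G c T u ∧
      TokenGame.multiplicity G c T u = TokenGame.multiplicity G c T v) ∧
    ∀ u, IsLeast
      {r : ℝ | ∃ T, TokenGame.IsGood G T ∧
        r = (TokenGame.period G c T : ℝ) / (TokenGame.multiplicity G c T u : ℝ)}
      (TokenGame.circularChromaticNumber G fun a b => (c a b : ℝ)) := by
  open TokenGame in
  refine ⟨fun T hT => exists_isPeriodicFrom hc hT, fun T hT u v =>
    ⟨multiplicity_pos hG hc hT u, multiplicity_eq hG hc (exists_isPeriodicFrom hc hT) u v⟩,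
    fun u => ?_⟩
  let ratio : (V → V → ℕ) → ℝ := fun T =>
    (TokenGame.period G c T : ℝ) / (TokenGame.multiplicity G c T u : ℝ)
  -- The markings with values `0` and `1`, among which are those of the colorings, are finitely many.
  let B : Set (V → V → ℕ) := {T | TokenGame.IsGood G T ∧ ∀ a b, T a b ≤ 1}
  have hBfin : B.Finite := by
    have hfin : (Set.univ.pi fun _ : V => Set.univ.pi fun _ : V => Set.Iic 1 :
        Set (V → V → ℕ)).Finite :=
      Set.Finite.pi fun _ => Set.Finite.pi fun _ => Set.finite_Iic 1
    exact hfin.subset fun T hT a _ b _ => hT.2 a b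
  have hBcol : ∀ {p : ℝ} {φ : V → ℝ},
      TokenGame.IsCircularColoring G (fun a b => (c a b : ℝ)) p φ →
      TokenGame.coloringMarking φ ∈ B := fun hφ =>
    ⟨hφ.isGood hc, TokenGame.coloringMarking_le_one _⟩
  have hBne : B.Nonempty := by
    obtain ⟨p, -, φ, hφ⟩ := TokenGame.exists_isCircularColoring G c
    exact ⟨_, hBcol hφ⟩
  obtain ⟨T₀, hT₀, hmin⟩ := Set.exists_min_image B ratio hBfin hBne
  have hleast : IsLeast {p : ℝ | 0 < p ∧
      ∃ φ : V → ℝ, TokenGame.IsCircularColoring G (fun a b => (c a b : ℝ)) p φ} (ratio T₀) := by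
    refine ⟨TokenGame.exists_isCircularColoring_period_div_multiplicity hG hc hT₀.1 u, ?_⟩
    rintro p ⟨-, φ, hφ⟩
    exact (hmin _ (hBcol hφ)).trans (hφ.period_div_multiplicity_le hG hc u)
  rw [TokenGame.circularChromaticNumber, hleast.csInf_eq]
  refine ⟨⟨T₀, hT₀.1, rfl⟩, ?_⟩
  rintro _ ⟨T, hT, rfl⟩
  -- Any good marking, 0-1 off the arcs or not, has a ratio that is itself a coloring perimeter.
  exact hleast.2 (TokenGame.exists_isCircularColoring_period_div_multiplicity hG hc hT u)
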